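/- Let $\mathbb T=\mathbb R/\mathbb Z$ with its geodesic distance $d$, let $\mathbb T^\infty$ be the set of all sequences $x=(x_i)_{i\ge1}$ in $\mathbb T$, and let $\sigma$ be the uniform probability measure on $\mathbb T^\infty$, that is, the completed product of the Haar probability measures on the factors. For $x,y\in\mathbb T^\infty$ put $d_p(x,y)=\bigl(\sum_{i\ge1}d(x_i,y_i)^p\bigr)^{1/p}\in[0,\infty]$ if $1<p<\infty$, and $d_\infty(x,y)=\sup_{i\ge1}d(x_i,y_i)$. A parallel infinite-dimensional subtorus is a set $M=\{x\in\mathbb T^\infty : x_i=b_i \text{ for all } i\in\mathbb N\setminus A\}$, where $A\subseteq\mathbb N$ is infinite and $b:\mathbb N\setminus A\to\mathbb T$; it carries the completed uniform probability measure of $\mathbb T^A\cong M$, to which $L^\infty(M)$ refers. Theorem. Let $1<p\le\infty$ and let $f:\mathbb T^\infty\to\mathbb R$ be a $\sigma$-measurable function which is Lipschitz with respect to $d_p$, that is, for some $L<\infty$ one has $|f(x)-f(y)|\le L\,d_p(x,y)$ whenever $d_p(x,y)<\infty$. Then there exists $a\in\mathbb R$ such that for every $\varepsilon>0$ there is a parallel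 infinite-dimensional subtorus $M\subseteq\mathbb T^\infty$ for which the restriction $f|_M$ is measurable and $\|f-a\|_{L^\infty(M)}<\varepsilon$. In other words, the set of all $a$ with this property, the infinite-dimensional spectrum of $f$, is non-empty. -/

import Mathlib

open MeasureTheory
open scoped ENNReal NNReal

/-- The infinite-dimensional torus: sequences of points of the circle `ℝ / ℤ`. -/
abbrev InfTorus : Type := ℕ → UnitAddCircle

namespace InfTorus

instance isProbabilityMeasure_circle :
    IsProbabilityMeasure (volume : Measure UnitAddCircle) :=
  ⟨UnitAddCircle.measure_univ⟩

/-- The uniform probability measure on the infinite-dimensional torus, i.e. the product of the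
Haar probability measures of the circles. Measurability with respect to its completion is
`MeasureTheory.NullMeasurable`. -/
noncomputable def uniform : Measure InfTorus :=
  Measure.infinitePi fun _ : ℕ => (volume : Measure UnitAddCircle)

/-- The `ℓ_p` distance on the infinite-dimensional torus, with values in `[0, ∞]`, where
`edist (x i) (y i)` is the geodesic distance on the circle `ℝ / ℤ`. -/
noncomputable def edistP (p : ℝ≥0∞) (x y : InfTorus) : ℝ≥0∞ :=
  if p = ∞ then ⨆ i, edist (x i) (y i)
  else (∑' i, edist (x i) (y i) ^ p.toReal) ^ (1 / p.toReal)

/-- `f` is Lipschitz for the `ℓ_p` distance, with some finite constant; nothing is asked for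
pairs of points at infinite distance. -/
def IsLipschitz (p : ℝ≥0∞) (f : InfTorus → ℝ) : Prop :=
  ∃ L : ℝ≥0, ∀ x y : InfTorus, edistP p x y ≠ ∞ → edist (f x) (f y) ≤ L * edistP p x y

end InfTorus

/-- A parallel infinite-dimensional subtorus: an infinite set `A` of free coordinates, and fixed
values `b` for all other coordinates. -/
structure ParallelSubtorus where
  A : Set ℕ
  infinite : A.Infinite
  b : ↥Aᶜ → UnitAddCircle

namespace ParallelSubtorus

/-- The underlying set of the subtorus. -/
def carrier (M : ParallelSubtorus) : Set InfTorus :=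
  {x | ∀ i : ↥M.Aᶜ, x i = M.b i}

open Classical in
/-- The parametrization of the subtorus by its free coordinates. -/
noncomputable def param (M : ParallelSubtorus) (y : ↥M.A → UnitAddCircle) : InfTorus :=
  fun i => if h : i ∈ M.A then y ⟨i, h⟩ else M.b ⟨i, h⟩

theorem range_param (M : ParallelSubtorus) : Set.range M.param = M.carrier := by
  ext x
  constructor
  · rintro ⟨y, rfl⟩ ⟨i, hi⟩
    have h : i ∉ M.A := hi
    simp [param, h]
  · intro hx
    refine ⟨fun i => x i, ?_⟩
    funext i
    by_cases h : i ∈ M.A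
    · simp [param, h]
    · simp only [param, h, dite_false]
      exact (hx ⟨i, h⟩).symm

theorem measurable_param (M : ParallelSubtorus) : Measurable M.param := by
  refine measurable_pi_lambda _ fun i => ?_
  by_cases h : i ∈ M.A
  · simpa [param, h] using measurable_pi_apply (⟨i, h⟩ : M.A)
  · simp [param, h]

/-- The uniform probability measure of the subtorus, viewed as a measure on the whole torus that
is concentrated on `M.carrier`: the image of the product of the Haar probability measures of the
circles with index in `A`. -/
noncomputable def uniform (M : ParallelSubtorus) : Measure InfTorus :=
  (Measure.infinitePi fun _ : ↥M.A => (volume : Measure UnitAddCircle)).map M.param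

instance (M : ParallelSubtorus) : IsProbabilityMeasure M.uniform :=
  Measure.isProbabilityMeasure_map M.measurable_param.aemeasurable

theorem measurableSet_carrier (M : ParallelSubtorus) : MeasurableSet M.carrier := by
  have h : M.carrier = ⋂ i : ↥M.Aᶜ, (fun x : InfTorus => x i) ⁻¹' {M.b i} := by
    ext x
    simp [carrier]
  rw [h]
  exact MeasurableSet.iInter fun i =>
    measurable_pi_apply (i : ℕ) (measurableSet_singleton (M.b i))

theorem uniform_compl_carrier (M : ParallelSubtorus) : M.uniform M.carrierᶜ = 0 := by
  rw [uniform, Measure.map_apply M.measurable_param M.measurableSet_carrier.compl,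
    ← range_param, Set.preimage_compl, Set.preimage_range, Set.compl_univ, measure_empty]

end ParallelSubtorus

/-!
The proof moves from a gradient bound to an oscillation bound in single coordinates, and from there
to infinitely many coordinates at once.

Because `p > 1`, a Lipschitz function for the `ℓ_p` distance varies by at most `K n * r` when `n`
coordinates move by at most `r` each, where `K n = L * n ^ (1 / p)` and `K n / n → 0`
(`InfTorus.IsFinLipschitz`). On a slice in `n` coordinates, Rademacher's theorem gives a gradient
almost everywhere, and its `ℓ₁` norm is at most `K n`. Translation invariance and Fubini carry this
over to almost every point of the torus, so that the `L₁` oscillations of `f` in `n` given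
coordinates have total at most `K n` per unit of shift
(`InfTorus.sum_lintegral_edist_single_le`). No integrability of `f` enters, only that of its
increments, which are bounded. Hence outside every finite set `S` of coordinates there is one with
very small oscillation. Finite nets and the Lipschitz bound make this uniform over all values of the
coordinates in `S`, off a set of small measure (`InfTorus.exists_notMem_measure_osc_le`).

Choosing coordinates one after another, with summable errors, gives an infinite set `A` such that,
off a set `N` of measure less than any prescribed `η > 0`, finitely many coordinates of a point
can be moved within `A` while `f` changes by at most `ε`
(`InfTorus.exists_infinite_finiteChange_le`). Now let `a` be a point of the support of the law of
`f`, and take `η` to be the measure of `{|f - a| < ε}`. Some fibre `M` over the coordinates outside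
`A` meets `{|f - a| < ε} \ N` in positive measure. By Kolmogorov's zero-one law almost every point
of `M` is a finite modification of a point of that set
(`exists_finite_ne_of_infinitePi_pos`), so `|f - a| ≤ 2 ε` almost everywhere on `M`. The point `a`
was chosen before `ε`, so it serves every `ε`.
-/

open Filter Topology

/-! ### Translations -/

namespace InfTorus

instance : IsProbabilityMeasure uniform :=
  inferInstanceAs (IsProbabilityMeasure (Measure.infinitePi _))

theorem measurePreserving_add_right (t : InfTorus) :
    MeasurePreserving (fun x : InfTorus => x + t) uniform uniform := by
  refine ⟨by fun_prop, ?_⟩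
  have h := Measure.infinitePi_map_pi (fun _ : ℕ => (volume : Measure UnitAddCircle))
    (f := fun i z => z + t i) (fun i => by fun_prop)
  simp only [map_add_right_eq_self] at h
  exact h

/-! ### Lipschitz bounds when finitely many coordinates move -/

/-- `f` is `K n`-Lipschitz for the sup distance as long as at most `n` coordinates move. -/
def IsFinLipschitz (K : ℕ → ℝ≥0) (f : InfTorus → ℝ) : Prop :=
  ∀ (S : Finset ℕ) (x y : InfTorus) (r : ℝ≥0), (∀ i ∉ S, x i = y i) →
    (∀ i ∈ S, edist (x i) (y i) ≤ r) → edist (f x) (f y) ≤ K S.card * r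

theorem edistP_le {p : ℝ≥0∞} (hp : 1 < p) (S : Finset ℕ) (x y : InfTorus) (r : ℝ≥0)
    (h0 : ∀ i ∉ S, x i = y i) (hr : ∀ i ∈ S, edist (x i) (y i) ≤ r) :
    edistP p x y ≤ ((S.card : ℝ≥0) ^ (1 / p.toReal) : ℝ≥0) * r := by
  unfold edistP
  split_ifs with h
  · subst h
    simp only [ENNReal.toReal_top, div_zero, NNReal.rpow_zero, ENNReal.coe_one, one_mul]
    refine iSup_le fun i => ?_
    by_cases hi : i ∈ S
    · exact hr i hi
    · simp [h0 i hi]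
  · have hp' : 0 < p.toReal := ENNReal.toReal_pos (by positivity) h
    have h1 : ∑' i, edist (x i) (y i) ^ p.toReal ≤ (S.card : ℝ≥0∞) * (r : ℝ≥0∞) ^ p.toReal := by
      rw [tsum_eq_sum (s := S) fun i hi => by simp [h0 i hi, hp']]
      calc _ ≤ ∑ i ∈ S, (r : ℝ≥0∞) ^ p.toReal :=
            Finset.sum_le_sum fun i hi => ENNReal.rpow_le_rpow (hr i hi) hp'.le
        _ = _ := by simp
    calc _ ≤ ((S.card : ℝ≥0∞) * (r : ℝ≥0∞) ^ p.toReal) ^ (1 / p.toReal) :=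
          ENNReal.rpow_le_rpow h1 (by positivity)
      _ = _ := by
          rw [ENNReal.mul_rpow_of_nonneg _ _ (by positivity), ← ENNReal.rpow_mul,
            mul_one_div_cancel hp'.ne', ENNReal.rpow_one, ENNReal.coe_rpow_of_nonneg _ (by positivity),
            ENNReal.coe_natCast]

theorem IsLipschitz.exists_isFinLipschitz {p : ℝ≥0∞} (hp : 1 < p) {f : InfTorus → ℝ}
    (hL : IsLipschitz p f) :
    ∃ K : ℕ → ℝ≥0, IsFinLipschitz K f ∧ Tendsto (fun n : ℕ => (K n : ℝ) / n) atTop (𝓝 0) := by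
  obtain ⟨L, hL⟩ := hL
  refine ⟨fun n => L * (n : ℝ≥0) ^ (1 / p.toReal), fun S x y r h0 hr => ?_, ?_⟩
  · have h := edistP_le hp S x y r h0 hr
    refine (hL x y (ne_top_of_le_ne_top (by finiteness) h)).trans ?_
    push_cast
    rw [mul_assoc]
    gcongr
  · have hlt : 1 / p.toReal < 1 := by
      rcases eq_or_ne p ∞ with rfl | h
      · simp
      · have : 1 < p.toReal := by
          rw [← ENNReal.toReal_one]; exact (ENNReal.toReal_lt_toReal (by simp) h).2 hp
        rw [div_lt_one (by positivity)]; exact this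
    have h1 : Tendsto (fun n : ℕ => (L : ℝ) * (n : ℝ) ^ (-(1 - 1 / p.toReal))) atTop (𝓝 (L * 0)) :=
      ((tendsto_rpow_neg_atTop (sub_pos.2 hlt)).comp tendsto_natCast_atTop_atTop).const_mul _
    rw [mul_zero] at h1
    refine h1.congr' ?_
    filter_upwards [eventually_gt_atTop 0] with n hn
    have hn' : (0 : ℝ) < n := by exact_mod_cast hn
    push_cast
    rw [neg_sub, Real.rpow_sub hn', Real.rpow_one, mul_div_assoc]

/-! ### Slices in finitely many coordinates -/

/-- A measurable set is null if, from every starting point `x`, almost every translation of a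
measurable family takes `x` outside it. -/
theorem measure_eq_zero_of_sections {V : Type*} [MeasurableSpace V] (ν : Measure V) [SFinite ν]
    (hν : ν ≠ 0) {T : V → InfTorus} (hT : Measurable T) {B : Set InfTorus}
    (hB : MeasurableSet B) (h : ∀ x, ν {v | x + T v ∈ B} = 0) : uniform B = 0 := by
  have hm : Measurable fun z : InfTorus × V => z.1 + T z.2 := by fun_prop
  have h0 : (uniform.prod ν) ((fun z : InfTorus × V => z.1 + T z.2) ⁻¹' B) = 0 := by
    rw [Measure.measure_prod_null (hm hB)]
    exact .of_forall h
  rw [Measure.prod_apply_symm (hm hB)] at h0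
  have h1 : ∀ v, uniform ((fun x => (x, v)) ⁻¹' ((fun z : InfTorus × V => z.1 + T z.2) ⁻¹' B))
      = uniform B := fun v => (measurePreserving_add_right (T v)).measure_preimage hB.nullMeasurableSet
  simp only [h1, lintegral_const, mul_eq_zero, Measure.measure_univ_eq_zero] at h0
  exact h0.resolve_right hν

/-- The vectors of `ℝ^S`, read modulo `ℤ`, as points of the torus supported on `S`. -/
noncomputable def ofFinset (S : Finset ℕ) (v : S → ℝ) : InfTorus :=
  fun i => if h : i ∈ S then ((v ⟨i, h⟩ : ℝ) : UnitAddCircle) else 0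

theorem measurable_ofFinset (S : Finset ℕ) : Measurable (ofFinset S) := by
  refine measurable_pi_lambda _ fun i => ?_
  by_cases h : i ∈ S
  · simp only [ofFinset, h, dite_true]
    exact AddCircle.measurable_mk'.comp (measurable_pi_apply _)
  · simp [ofFinset, h]

theorem ofFinset_add (S : Finset ℕ) (v w : S → ℝ) :
    ofFinset S (v + w) = ofFinset S v + ofFinset S w := by
  ext i
  by_cases h : i ∈ S <;> simp [ofFinset, h]

theorem ofFinset_single (S : Finset ℕ) (i : S) (a : ℝ) :
    ofFinset S (Pi.single i a) = Pi.single (i : ℕ) (a : UnitAddCircle) := by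
  ext j
  by_cases h : j ∈ S
  · by_cases hj : j = i
    · subst hj; simp [ofFinset]
    · have : (⟨j, h⟩ : S) ≠ i := fun e => hj (by rw [← e])
      simp [ofFinset, h, this, hj]
  · have : j ≠ i := fun e => h (e ▸ i.2)
    simp [ofFinset, h, this]

theorem edist_coe_le (a b : ℝ) : edist (a : UnitAddCircle) (b : UnitAddCircle) ≤ edist a b := by
  rw [edist_dist, edist_dist, dist_eq_norm, dist_eq_norm, ← AddCircle.coe_sub]
  exact ENNReal.ofReal_le_ofReal (QuotientAddGroup.norm_mk_le_norm)

theorem IsFinLipschitz.lipschitzWith_slice {K : ℕ → ℝ≥0} {f : InfTorus → ℝ}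
    (hf : IsFinLipschitz K f) (S : Finset ℕ) (x : InfTorus) :
    LipschitzWith (K S.card) fun v : S → ℝ => f (x + ofFinset S v) := by
  intro v w
  rw [edist_nndist v w]
  refine hf S _ _ _ (fun i hi => by simp [ofFinset, hi]) fun i hi => ?_
  rw [← edist_nndist, Pi.add_apply, Pi.add_apply, edist_add_left]
  simp only [ofFinset, hi, dite_true]
  exact (edist_coe_le _ _).trans (edist_le_pi_edist v w ⟨i, hi⟩)

/-- At a point of differentiability the absolute coordinate difference quotients have, in the limit,
a sum of at most `K * |s|`: it is the value of the derivative at a vector with entries `s` up to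
sign, whose sup norm is at most `|s|`. -/
theorem tendsto_diffQuot {ι : Type*} [Fintype ι] [DecidableEq ι] {K : ℝ≥0} {g : (ι → ℝ) → ℝ}
    (hg : LipschitzWith K g) {v : ι → ℝ} (hv : DifferentiableAt ℝ g v) (s : ℝ) :
    ∃ l ≤ K * |s|, Tendsto (fun m : ℕ => ∑ i, 2 ^ m * |g (v + Pi.single i (s / 2 ^ m)) - g v|)
      atTop (𝓝 l) := by
  set D := fderiv ℝ g v with hD
  refine ⟨∑ i, |D (Pi.single i s)|, ?_, ?_⟩
  · set w : ι → ℝ := fun i => SignType.sign (D (Pi.single i s)) * s with hw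
    have h1 : D w = ∑ i, |D (Pi.single i s)| := by
      have : w = ∑ i, (SignType.sign (D (Pi.single i s)) : ℝ) • Pi.single i s := by
        ext j; simp [hw, Finset.sum_apply, Pi.single_apply]
      rw [this, map_sum]
      simp only [map_smul, smul_eq_mul, sign_mul_self]
    have h2 : ‖w‖ ≤ |s| := by
      refine (pi_norm_le_iff_of_nonneg (abs_nonneg _)).2 fun i => ?_
      simp only [hw, norm_mul, Real.norm_eq_abs]
      refine mul_le_of_le_one_left (abs_nonneg _) ?_
      rcases SignType.sign (D (Pi.single i s)) with _ | _ | _ <;> simp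
    rw [← h1]
    calc D w ≤ ‖D w‖ := le_abs_self _
      _ ≤ ‖D‖ * ‖w‖ := D.le_opNorm w
      _ ≤ K * |s| := by
        gcongr
        exact norm_fderiv_le_of_lipschitz ℝ hg
  · refine tendsto_finsetSum _ fun i _ => ?_
    have h := (hv.hasFDerivAt.lim (Pi.single i s) (c := fun m : ℕ => (2 : ℝ) ^ m) (l := atTop)
      (by simpa using tendsto_pow_atTop_atTop_of_one_lt (one_lt_two (α := ℝ)))).abs
    refine h.congr fun m => ?_
    rw [smul_eq_mul, abs_mul, abs_of_pos (by positivity), ← Pi.single_smul, smul_eq_mul,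
      inv_mul_eq_div]

/-! ### The `L₁` oscillation in single coordinates -/

theorem IsFinLipschitz.edist_single_le {K : ℕ → ℝ≥0} {f : InfTorus → ℝ}
    (hf : IsFinLipschitz K f) (x : InfTorus) (i : ℕ) (θ θ' : UnitAddCircle) :
    edist (f (x + Pi.single i θ)) (f (x + Pi.single i θ')) ≤ K 1 * edist θ θ' := by
  have h := hf {i} (x + Pi.single i θ) (x + Pi.single i θ') (nndist θ θ')
    (fun j hj => by simp [Finset.mem_singleton.not.1 hj])
    (fun j hj => by rw [Finset.mem_singleton.1 hj, ← edist_nndist]; simp)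
  rwa [Finset.card_singleton, ← edist_nndist] at h

/-- At almost every point the difference quotients in the coordinates of `S` satisfy in the limit
the `ℓ₁` bound on the gradient, by Rademacher's theorem on the slices `x + ℝ^S`. -/
theorem ae_limsup_diffQuot_le {K : ℕ → ℝ≥0} {f : InfTorus → ℝ} (hf : IsFinLipschitz K f)
    (hm : AEMeasurable f uniform) (S : Finset ℕ) (s : ℝ) :
    ∀ᵐ x ∂uniform, limsup (fun m : ℕ => ∑ i ∈ S, (2 : ℝ≥0∞) ^ m *
      edist (f (x + Pi.single i ((s / 2 ^ m : ℝ) : UnitAddCircle))) (f x)) atTop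
        ≤ K S.card * ‖s‖₊ := by
  set q : ℕ → InfTorus → ℝ≥0∞ := fun m x => ∑ i ∈ S, (2 : ℝ≥0∞) ^ m *
      edist (f (x + Pi.single i ((s / 2 ^ m : ℝ) : UnitAddCircle))) (f x) with hq
  have hqm : ∀ m, AEMeasurable (q m) uniform := fun m =>
    Finset.aemeasurable_fun_sum _ fun i _ => ((hm.comp_quasiMeasurePreserving
      (measurePreserving_add_right _).quasiMeasurePreserving).edist hm).const_mul _
  have hN : NullMeasurableSet {x | K S.card * ‖s‖₊ < limsup (fun m => q m x) atTop} uniform := by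
    have h1 : MeasurableSet {x | (K S.card * ‖s‖₊ : ℝ≥0∞) <
        limsup (fun m => (hqm m).mk _ x) atTop} :=
      measurableSet_lt measurable_const (Measurable.limsup fun m => (hqm m).measurable_mk)
    refine h1.nullMeasurableSet.congr ?_
    filter_upwards [ae_all_iff.2 fun m => (hqm m).ae_eq_mk] with x hx
    have : (fun m => q m x) = fun m => (hqm m).mk _ x := funext hx
    exact congrArg (fun u : ℕ → ℝ≥0∞ => K S.card * ‖s‖₊ < limsup u atTop) this.symm
  obtain ⟨B, hBs, hB, hBe⟩ := hN.exists_measurable_subset_ae_eq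
  have key : uniform B = 0 := by
    refine measure_eq_zero_of_sections (volume : Measure (S → ℝ)) (NeZero.ne _)
      (measurable_ofFinset S) hB fun x => ?_
    have hlip := hf.lipschitzWith_slice S x
    refine measure_mono_null (t := {v | ¬ DifferentiableAt ℝ (fun v => f (x + ofFinset S v)) v})
      (fun v hv hd => ?_) (ae_iff.1 hlip.ae_differentiableAt)
    obtain ⟨l, hl, ht⟩ := tendsto_diffQuot hlip hd s
    have hlt : (K S.card * ‖s‖₊ : ℝ≥0∞) < limsup (fun m => q m (x + ofFinset S v)) atTop := hBs hv
    refine hlt.not_ge ?_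
    have h2 : Tendsto (fun m => q m (x + ofFinset S v)) atTop (𝓝 (ENNReal.ofReal l)) := by
      refine ((ENNReal.continuous_ofReal.tendsto l).comp ht).congr fun m => ?_
      simp only [Function.comp_apply, hq]
      rw [ENNReal.ofReal_sum_of_nonneg fun _ _ => by positivity, ← Finset.sum_coe_sort S]
      refine Finset.sum_congr rfl fun i _ => ?_
      rw [ENNReal.ofReal_mul (by positivity), ofFinset_add, ofFinset_single, add_assoc,
        edist_dist, Real.dist_eq, ENNReal.ofReal_pow (by norm_num), ENNReal.ofReal_ofNat]
    rw [h2.limsup_eq]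
    calc ENNReal.ofReal l ≤ ENNReal.ofReal (K S.card * |s|) := ENNReal.ofReal_le_ofReal hl
      _ = _ := by
        rw [ENNReal.ofReal_mul (by positivity), ENNReal.ofReal_coe_nnreal, ← Real.norm_eq_abs,
          ofReal_norm, enorm_eq_nnnorm]
  rw [ae_iff]
  simp only [not_le]
  rw [← measure_congr hBe, key]

theorem lintegral_edist_single_le_two_pow {f : InfTorus → ℝ}
    (hm : AEMeasurable f uniform) (i : ℕ) (s : ℝ) (m : ℕ) :
    ∫⁻ x, edist (f (x + Pi.single i (s : UnitAddCircle))) (f x) ∂uniform ≤ 2 ^ m *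
      ∫⁻ x, edist (f (x + Pi.single i ((s / 2 ^ m : ℝ) : UnitAddCircle))) (f x) ∂uniform := by
  have hmt : ∀ t, AEMeasurable (fun x => f (x + t)) uniform := fun t =>
    hm.comp_quasiMeasurePreserving (measurePreserving_add_right t).quasiMeasurePreserving
  induction m with
  | zero => simp
  | succ m ih =>
    refine ih.trans ?_
    rw [pow_succ, mul_assoc]
    gcongr
    set h : ℝ := s / 2 ^ (m + 1) with hh
    have e : s / 2 ^ m = h + h := by rw [hh, pow_succ]; field_simp; norm_num
    set t : InfTorus := Pi.single i (h : UnitAddCircle) with ht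
    have e' : (Pi.single i ((s / 2 ^ m : ℝ) : UnitAddCircle) : InfTorus) = t + t := by
      rw [ht, ← Pi.single_add, e, AddCircle.coe_add]
    rw [e', two_mul]
    calc ∫⁻ x, edist (f (x + (t + t))) (f x) ∂uniform
        ≤ ∫⁻ x, (edist (f (x + t + t)) (f (x + t)) + edist (f (x + t)) (f x)) ∂uniform :=
          lintegral_mono fun x => by rw [← add_assoc]; exact edist_triangle _ _ _
      _ = ∫⁻ x, edist (f (x + t + t)) (f (x + t)) ∂uniform +
            ∫⁻ x, edist (f (x + t)) (f x) ∂uniform :=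
          lintegral_add_right' _ ((hmt t).edist hm)
      _ = _ := by
          congr 1
          have hg : AEMeasurable (fun x => edist (f (x + t)) (f x)) uniform := (hmt t).edist hm
          have hp := measurePreserving_add_right t
          rw [← lintegral_map' (f := fun x => edist (f (x + t)) (f x)) (g := fun x => x + t)
            (by rwa [hp.map_eq]) hp.measurable.aemeasurable, hp.map_eq]

/-- The `L₁` oscillations in the coordinates of `S` have total at most the Lipschitz constant on
`S`. The oscillation at scale `s` is dominated by the rescaled one at scale `s / 2 ^ m`, to which
the infinitesimal bound applies as `m → ∞`. -/
theorem sum_lintegral_edist_single_le {K : ℕ → ℝ≥0} {f : InfTorus → ℝ} (hf : IsFinLipschitz K f)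
    (hm : AEMeasurable f uniform) (S : Finset ℕ) (s : ℝ) :
    ∑ i ∈ S, ∫⁻ x, edist (f (x + Pi.single i (s : UnitAddCircle))) (f x) ∂uniform
      ≤ K S.card * ‖s‖₊ := by
  have hi : ∀ i (h : ℝ), AEMeasurable
      (fun x => edist (f (x + Pi.single i (h : UnitAddCircle))) (f x)) uniform := fun i h =>
    (hm.comp_quasiMeasurePreserving
      (measurePreserving_add_right _).quasiMeasurePreserving).edist hm
  set q : ℕ → InfTorus → ℝ≥0∞ := fun m x => ∑ i ∈ S, (2 : ℝ≥0∞) ^ m *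
      edist (f (x + Pi.single i ((s / 2 ^ m : ℝ) : UnitAddCircle))) (f x) with hq
  have hqm : ∀ m, AEMeasurable (q m) uniform := fun m =>
    Finset.aemeasurable_fun_sum _ fun i _ => (hi i _).const_mul _
  have hqb : ∀ m x, q m x ≤ S.card * (K 1 * ‖s‖₊) := fun m x => by
    simp only [hq]
    rw [← nsmul_eq_mul]
    refine Finset.sum_le_card_nsmul _ _ _ fun i _ => ?_
    have h := hf.edist_single_le x i ((s / 2 ^ m : ℝ) : UnitAddCircle) ((0 : ℝ) : UnitAddCircle)
    have h' := edist_coe_le (s / 2 ^ m) 0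
    rw [AddCircle.coe_zero, Pi.single_zero, add_zero] at h
    rw [AddCircle.coe_zero, edist_zero_right (s / 2 ^ m)] at h'
    calc (2 : ℝ≥0∞) ^ m * edist (f (x + Pi.single i ((s / 2 ^ m : ℝ) : UnitAddCircle))) (f x)
        ≤ 2 ^ m * (K 1 * ‖s / 2 ^ m‖ₑ) := by gcongr; exact h.trans (by gcongr)
      _ = K 1 * ‖(2 : ℝ) ^ m * (s / 2 ^ m)‖ₑ := by
        rw [enorm_mul, enorm_pow, show ‖(2 : ℝ)‖ₑ = 2 by simp [enorm_eq_nnnorm]]; ring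
      _ = K 1 * ‖s‖₊ := by rw [mul_div_cancel₀ _ (by positivity), enorm_eq_nnnorm]
  calc ∑ i ∈ S, ∫⁻ x, edist (f (x + Pi.single i (s : UnitAddCircle))) (f x) ∂uniform
      ≤ limsup (fun m => ∫⁻ x, q m x ∂uniform) atTop := by
        refine le_limsup_of_frequently_le (Frequently.of_forall fun m => ?_) (by isBoundedDefault)
        simp only [hq]
        rw [lintegral_finsetSum' _ fun i _ => (hi i _).const_mul _]
        refine Finset.sum_le_sum fun i _ => ?_
        rw [lintegral_const_mul'' _ (hi i _)]
        exact lintegral_edist_single_le_two_pow hm i s m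
    _ = limsup (fun m => ∫⁻ x, (hqm m).mk _ x ∂uniform) atTop := by
        congr 1; funext m; exact lintegral_congr_ae (hqm m).ae_eq_mk
    _ ≤ ∫⁻ x, limsup (fun m => (hqm m).mk _ x) atTop ∂uniform := by
        refine limsup_lintegral_le (fun _ => S.card * (K 1 * ‖s‖₊)) (fun m => (hqm m).measurable_mk)
          (fun m => ?_) (by rw [lintegral_const]; finiteness)
        filter_upwards [(hqm m).ae_eq_mk] with x hx
        rw [← hx]; exact hqb m x
    _ ≤ ∫⁻ x, K S.card * ‖s‖₊ ∂uniform := by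
        refine lintegral_mono_ae ?_
        filter_upwards [ae_all_iff.2 fun m => (hqm m).ae_eq_mk,
          ae_limsup_diffQuot_le hf hm S s] with x hx hl
        have : (fun m => q m x) = fun m => (hqm m).mk _ x := funext hx
        rw [← this]; exact hl
    _ = _ := by simp

/-! ### Coordinates of uniformly small oscillation -/

/-- For finitely many shifts `s`, some coordinate outside `S` has small `L₁` oscillation under all of
them: otherwise `n` such coordinates would violate the bound on their total once `K n / n` is
small. -/
theorem exists_notMem_sum_lintegral_le {K : ℕ → ℝ≥0} {f : InfTorus → ℝ} (hf : IsFinLipschitz K f)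
    (hK : Tendsto (fun n : ℕ => (K n : ℝ) / n) atTop (𝓝 0)) (hm : AEMeasurable f uniform)
    (S : Finset ℕ) (N : Finset ℝ) {η : ℝ≥0} (hη : 0 < η) :
    ∃ i ∉ S, ∑ s ∈ N, ∫⁻ x, edist (f (x + Pi.single i (s : UnitAddCircle))) (f x) ∂uniform ≤ η := by
  obtain ⟨ψ, hψ⟩ : ∃ ψ : ℕ → ℝ → ℝ≥0∞, ∀ i s, ψ i s =
      ∫⁻ x, edist (f (x + Pi.single i (s : UnitAddCircle))) (f x) ∂uniform :=
    ⟨_, fun _ _ => rfl⟩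
  simp only [← hψ]
  have hsum : ∀ (T : Finset ℕ) (s : ℝ), ∑ i ∈ T, ψ i s ≤ K T.card * ‖s‖₊ := fun T s => by
    simp only [hψ]
    exact sum_lintegral_edist_single_le hf hm T s
  by_contra! hcon
  set C : ℝ≥0 := ∑ s ∈ N, ‖s‖₊ with hC
  have h1 : ∀ n : ℕ, n * η ≤ K n * C := fun n => by
    obtain ⟨T, hT, rfl⟩ := (S.finite_toSet.infinite_compl).exists_subset_card_eq n
    have : ((T.card * η : ℝ≥0) : ℝ≥0∞) ≤ ((K T.card * C : ℝ≥0) : ℝ≥0∞) := by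
      calc ((T.card * η : ℝ≥0) : ℝ≥0∞) = ∑ i ∈ T, (η : ℝ≥0∞) := by simp
        _ ≤ ∑ i ∈ T, ∑ s ∈ N, ψ i s :=
          Finset.sum_le_sum fun i hi => (hcon i (hT (Finset.mem_coe.2 hi))).le
        _ = ∑ s ∈ N, ∑ i ∈ T, ψ i s := Finset.sum_comm
        _ ≤ ∑ s ∈ N, (K T.card : ℝ≥0∞) * ‖s‖₊ := Finset.sum_le_sum fun s _ => hsum T s
        _ = _ := by rw [hC, ← Finset.mul_sum]; push_cast; rfl
    exact_mod_cast this
  have h2 : ∀ᶠ n : ℕ in atTop, (η : ℝ) ≤ K n / n * C := by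
    filter_upwards [eventually_gt_atTop 0] with n hn
    have hn' : (0 : ℝ) < n := by exact_mod_cast hn
    have h3 : (n : ℝ) * η ≤ K n * C := by exact_mod_cast h1 n
    rw [div_mul_eq_mul_div, le_div_iff₀ hn']
    linarith
  have h3 := ge_of_tendsto (hK.mul_const (C : ℝ)) h2
  rw [zero_mul] at h3
  exact hη.not_ge (by exact_mod_cast h3)

theorem exists_finset_net_circle {δ : ℝ≥0} (hδ : 0 < δ) :
    ∃ N : Finset ℝ, ∀ θ : UnitAddCircle, ∃ s ∈ N, edist θ (s : UnitAddCircle) ≤ δ := by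
  obtain ⟨t, -, htf, ht⟩ := finite_cover_balls_of_compact
    (isCompact_univ (X := UnitAddCircle)) (NNReal.coe_pos.2 hδ)
  refine ⟨htf.toFinset.image Quotient.out, fun θ => ?_⟩
  obtain ⟨y, hy, hd⟩ := Set.mem_iUnion₂.1 (ht (Set.mem_univ θ))
  refine ⟨Quotient.out y, Finset.mem_image_of_mem _ (htf.mem_toFinset.2 hy), ?_⟩
  have : ((Quotient.out y : ℝ) : UnitAddCircle) = y := Quotient.out_eq y
  rw [this, edist_nndist]
  exact_mod_cast (Metric.mem_ball.1 hd).le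

theorem exists_finset_net_supported (S : Finset ℕ) {δ : ℝ≥0} (hδ : 0 < δ) :
    ∃ W : Finset InfTorus, ∀ t : InfTorus, (∀ i ∉ S, t i = 0) →
      ∃ w ∈ W, (∀ i ∉ S, t i = w i) ∧ ∀ i ∈ S, edist (t i) (w i) ≤ δ := by
  classical
  obtain ⟨N, -, hNf, hN⟩ := finite_cover_balls_of_compact
    (isCompact_univ (X := S → UnitAddCircle)) (NNReal.coe_pos.2 hδ)
  refine ⟨hNf.toFinset.image fun y i => if h : i ∈ S then y ⟨i, h⟩ else 0, fun t ht => ?_⟩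
  obtain ⟨y, hy, hd⟩ := Set.mem_iUnion₂.1 (hN (Set.mem_univ fun i : S => t i))
  refine ⟨_, Finset.mem_image_of_mem _ (hNf.mem_toFinset.2 hy), fun i hi => by simp [hi, ht i hi],
    fun i hi => ?_⟩
  simp only [hi, dite_true]
  refine (edist_le_pi_edist (fun i : S => t i) y ⟨i, hi⟩).trans ?_
  rw [edist_nndist]
  exact_mod_cast (Metric.mem_ball.1 hd).le

/-- The passage from finitely many shifts to all of them: the oscillation in coordinate `i` is
small uniformly over all positions of the coordinates in `S`, off a set of small measure. -/
theorem exists_notMem_measure_osc_le {K : ℕ → ℝ≥0} {f : InfTorus → ℝ} (hf : IsFinLipschitz K f)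
    (hK : Tendsto (fun n : ℕ => (K n : ℝ) / n) atTop (𝓝 0)) (hm : AEMeasurable f uniform)
    (S : Finset ℕ) {ε η : ℝ≥0} (hε : 0 < ε) (hη : 0 < η) :
    ∃ i ∉ S, uniform {x | ∃ t : InfTorus, (∀ j ∉ S, t j = 0) ∧ ∃ θ : UnitAddCircle,
      ε < edist (f (x + t + Pi.single i θ)) (f (x + t))} ≤ η := by
  -- `δ` makes the error of replacing `t` and `θ` by points of the nets at most `ε / 2`
  set δ : ℝ≥0 := ε / 2 / (K (S.card + 1) + K S.card + 1) with hδ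
  have hδ0 : 0 < δ := by positivity
  have hδ1 : K (S.card + 1) * δ + K S.card * δ ≤ ε / 2 := by
    rw [← add_mul, hδ, mul_div_assoc', div_le_iff₀ (by positivity), mul_comm]
    exact mul_le_mul' le_rfl le_self_add
  obtain ⟨N, hN⟩ := exists_finset_net_circle hδ0
  obtain ⟨W, hW⟩ := exists_finset_net_supported S hδ0
  obtain ⟨i, hi, hsum⟩ := exists_notMem_sum_lintegral_le hf hK hm S N
    (η := η * (ε / 2) / (W.card + 1)) (by positivity)
  refine ⟨i, hi, ?_⟩
  set h : ℝ → InfTorus → ℝ≥0∞ :=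
    fun s x => edist (f (x + Pi.single i (s : UnitAddCircle))) (f x) with hh
  have hhm : ∀ s, AEMeasurable (h s) uniform := fun s => (hm.comp_quasiMeasurePreserving
    (measurePreserving_add_right _).quasiMeasurePreserving).edist hm
  have hsub : {x | ∃ t : InfTorus, (∀ j ∉ S, t j = 0) ∧ ∃ θ : UnitAddCircle,
      (ε : ℝ≥0∞) < edist (f (x + t + Pi.single i θ)) (f (x + t))} ⊆
      ⋃ w ∈ W, ⋃ s ∈ N, (fun x => x + w) ⁻¹' {x | ((ε / 2 : ℝ≥0) : ℝ≥0∞) ≤ h s x} := by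
    rintro x ⟨t, ht, θ, hlt⟩
    obtain ⟨w, hw, hw0, hw1⟩ := hW t ht
    obtain ⟨s, hs, hsθ⟩ := hN θ
    simp only [Set.mem_iUnion]
    refine ⟨w, hw, s, hs, ?_⟩
    show ((ε / 2 : ℝ≥0) : ℝ≥0∞) ≤ h s (x + w)
    by_contra! hc
    have e1 : edist (f (x + t + Pi.single i θ)) (f (x + w + Pi.single i (s : UnitAddCircle)))
        ≤ K (S.card + 1) * δ := by
      rw [← Finset.card_insert_of_notMem hi]
      refine hf (insert i S) _ _ δ (fun j hj => ?_) fun j hj => ?_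
      · rw [Finset.mem_insert, not_or] at hj
        simp [hj.1, hw0 j hj.2]
      · rcases Finset.mem_insert.1 hj with rfl | hj
        · simpa [hw0 j hi] using hsθ
        · have : j ≠ i := fun e => hi (e ▸ hj)
          simpa [this] using hw1 j hj
    have e2 : edist (f (x + w)) (f (x + t)) ≤ K S.card * δ := by
      rw [edist_comm]
      exact hf S _ _ δ (fun j hj => by simp [hw0 j hj]) fun j hj => by simpa using hw1 j hj
    refine hlt.not_ge ?_
    calc edist (f (x + t + Pi.single i θ)) (f (x + t))
        ≤ K (S.card + 1) * δ + h s (x + w) + K S.card * δ :=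
          (edist_triangle4 _ _ _ _).trans (add_le_add (add_le_add e1 le_rfl) e2)
      _ ≤ K (S.card + 1) * δ + ((ε / 2 : ℝ≥0) : ℝ≥0∞) + K S.card * δ := by gcongr
      _ = ((K (S.card + 1) * δ + K S.card * δ + ε / 2 : ℝ≥0) : ℝ≥0∞) := by push_cast; ring
      _ ≤ ε := by
        rw [ENNReal.coe_le_coe]
        calc _ ≤ ε / 2 + ε / 2 := by gcongr
          _ = ε := add_halves ε
  have hmark : ∀ s, uniform {x | ((ε / 2 : ℝ≥0) : ℝ≥0∞) ≤ h s x} ≤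
      (∫⁻ x, h s x ∂uniform) / (ε / 2 : ℝ≥0) := fun s =>
    meas_ge_le_lintegral_div (hhm s) (by simpa using hε.ne') ENNReal.coe_ne_top
  calc _ ≤ uniform (⋃ w ∈ W, ⋃ s ∈ N,
          (fun x => x + w) ⁻¹' {x | ((ε / 2 : ℝ≥0) : ℝ≥0∞) ≤ h s x}) := measure_mono hsub
    _ ≤ ∑ w ∈ W, ∑ s ∈ N,
          uniform ((fun x => x + w) ⁻¹' {x | ((ε / 2 : ℝ≥0) : ℝ≥0∞) ≤ h s x}) :=
        (measure_biUnion_finset_le _ _).trans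
          (Finset.sum_le_sum fun w _ => measure_biUnion_finset_le _ _)
    _ ≤ ∑ w ∈ W, ∑ s ∈ N, (∫⁻ x, h s x ∂uniform) / (ε / 2 : ℝ≥0) := by
        refine Finset.sum_le_sum fun w _ => Finset.sum_le_sum fun s _ => ?_
        rw [(measurePreserving_add_right w).measure_preimage
          (nullMeasurableSet_le aemeasurable_const (hhm s))]
        exact hmark s
    _ = W.card * ((∑ s ∈ N, ∫⁻ x, h s x ∂uniform) / (ε / 2 : ℝ≥0)) := by
        simp only [div_eq_mul_inv, Finset.sum_mul, Finset.sum_const, nsmul_eq_mul]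
    _ ≤ W.card * (((η * (ε / 2) / (W.card + 1) : ℝ≥0) : ℝ≥0∞) / (ε / 2 : ℝ≥0)) := by gcongr
    _ = ((W.card * (η * (ε / 2) / (W.card + 1) / (ε / 2)) : ℝ≥0) : ℝ≥0∞) := by
        rw [ENNReal.coe_mul, ENNReal.coe_div (by positivity : ε / 2 ≠ 0), ENNReal.coe_natCast]
    _ ≤ η := by
        rw [ENNReal.coe_le_coe]
        have : (W.card : ℝ≥0) * (η * (ε / 2) / (W.card + 1) / (ε / 2))
            = η * (W.card / (W.card + 1)) := by
          field_simp
        rw [this]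
        exact mul_le_of_le_one_right (zero_le) (div_le_one_of_le₀ le_self_add zero_le)

/-- An infinite set of coordinates that can be moved, finitely many at a time, without changing
`f` by more than `ε`, starting from any point off a set of small measure. -/
theorem exists_infinite_finiteChange_le {K : ℕ → ℝ≥0} {f : InfTorus → ℝ} (hf : IsFinLipschitz K f)
    (hK : Tendsto (fun n : ℕ => (K n : ℝ) / n) atTop (𝓝 0)) (hm : AEMeasurable f uniform)
    {ε η : ℝ≥0∞} (hε : ε ≠ 0) (hη : η ≠ 0) :
    ∃ (A : Set ℕ) (N : Set InfTorus), A.Infinite ∧ uniform N < η ∧ ∀ x ∉ N, ∀ y,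
      ∀ F : Finset ℕ, ↑F ⊆ A → (∀ i ∉ F, x i = y i) → edist (f y) (f x) ≤ ε := by
  obtain ⟨e, he0, he⟩ := ENNReal.exists_pos_sum_of_countable hε ℕ
  obtain ⟨d, hd0, hd⟩ := ENNReal.exists_pos_sum_of_countable hη ℕ
  choose g hg hgd using fun (k : ℕ) (S : Finset ℕ) =>
    exists_notMem_measure_osc_le hf hK hm S (he0 k) (hd0 k)
  obtain ⟨S, hS0, hS⟩ : ∃ S : ℕ → Finset ℕ, S 0 = ∅ ∧
      ∀ k, S (k + 1) = insert (g k (S k)) (S k) :=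
    ⟨fun k => Nat.rec ∅ (fun k S => insert (g k S) S) k, rfl, fun _ => rfl⟩
  have hmono : Monotone S := monotone_nat_of_le_succ fun k => by
    rw [hS]; exact Finset.subset_insert _ _
  have hinj : Function.Injective fun k => g k (S k) := by
    have hne : ∀ j k, j < k → g j (S j) ≠ g k (S k) := fun j k hjk h => by
      refine hg k (S k) ?_
      rw [← h]
      refine hmono (Nat.succ_le_of_lt hjk) ?_
      rw [Nat.succ_eq_add_one, hS]
      exact Finset.mem_insert_self _ _
    intro j k h
    by_contra hjk
    rcases lt_or_gt_of_ne hjk with hlt | hlt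
    · exact hne j k hlt h
    · exact hne k j hlt h.symm
  have hcover : ∀ F : Finset ℕ, (F : Set ℕ) ⊆ Set.range (fun k => g k (S k)) →
      ∃ k, F ⊆ S k := by
    intro F
    induction F using Finset.induction_on with
    | empty => exact fun _ => ⟨0, Finset.empty_subset _⟩
    | insert a F _ ih =>
      intro h
      rw [Finset.coe_insert, Set.insert_subset_iff] at h
      obtain ⟨⟨j, hj⟩, h⟩ := h
      obtain ⟨k, hk⟩ := ih h
      refine ⟨max (j + 1) k, Finset.insert_subset ?_ (hk.trans (hmono (le_max_right _ _)))⟩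
      refine hmono (le_max_left _ _) ?_
      rw [hS, ← hj]
      exact Finset.mem_insert_self _ _
  set N : ℕ → Set InfTorus := fun k => {x | ∃ t : InfTorus, (∀ j ∉ S k, t j = 0) ∧
    ∃ θ : UnitAddCircle,
      (e k : ℝ≥0∞) < edist (f (x + t + Pi.single (g k (S k)) θ)) (f (x + t))} with hN
  have hNd : uniform (⋃ k, N k) < η := calc
    uniform (⋃ k, N k) ≤ ∑' k, uniform (N k) := measure_iUnion_le _
    _ ≤ ∑' k, (d k : ℝ≥0∞) := ENNReal.tsum_le_tsum fun k => hgd k (S k)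
    _ < η := hd
  refine ⟨Set.range fun k => g k (S k), ⋃ k, N k, Set.infinite_range_of_injective hinj, hNd,
    fun x hx y F hF hxy => ?_⟩
  rw [Set.mem_iUnion, not_exists] at hx
  have key : ∀ k, ∀ t : InfTorus, (∀ j ∉ S k, t j = 0) →
      edist (f (x + t)) (f x) ≤ ∑ j ∈ Finset.range k, (e j : ℝ≥0∞) := by
    intro k
    induction k with
    | zero =>
      intro t ht
      have : t = 0 := funext fun j => ht j (by simp [hS0])
      simp [this]
    | succ k ih =>
      intro t ht
      -- move the coordinates in `S k` first; then `x ∉ N k` bounds the move of `g k (S k)`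
      set t' : InfTorus := Function.update t (g k (S k)) 0 with ht'
      have h0 : ∀ j ∉ S k, t' j = 0 := fun j hj => by
        by_cases hjg : j = g k (S k)
        · simp [ht', hjg]
        · rw [ht', Function.update_of_ne hjg]
          exact ht j (by rw [hS, Finset.mem_insert, not_or]; exact ⟨hjg, hj⟩)
      have hadd : x + t = x + t' + Pi.single (g k (S k)) (t (g k (S k))) := by
        ext j
        by_cases hjg : j = g k (S k)
        · subst hjg; simp [ht']
        · simp [ht', hjg]
      have h1 : edist (f (x + t)) (f (x + t')) ≤ e k := by
        rw [hadd]
        exact not_lt.1 fun hlt => hx k ⟨t', h0, _, hlt⟩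
      rw [Finset.sum_range_succ]
      exact (edist_triangle _ _ _).trans ((add_le_add h1 (ih t' h0)).trans_eq (add_comm _ _))
  obtain ⟨k, hk⟩ := hcover F hF
  have h := key k (y - x) fun j hj => by simp [hxy j fun h => hj (hk h)]
  rw [add_sub_cancel] at h
  exact h.trans ((ENNReal.sum_le_tsum _).trans he.le)

end InfTorus

/-! ### Finite modifications and fibres -/

/-- Two sets of positive measure in a countable product contain points that agree off a finite set
of indices. The set of all points differing finitely from a compact subset of `B` is a tail event
of positive measure. -/
theorem exists_finite_ne_of_infinitePi_pos {ι X : Type*} [Countable ι] [TopologicalSpace X]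
    [MeasurableSpace X] [BorelSpace X] [SecondCountableTopology X] [T2Space X]
    (μ : Measure X) [IsProbabilityMeasure μ]
    [(Measure.infinitePi fun _ : ι => μ).InnerRegular] {B C : Set (ι → X)}
    (hB : NullMeasurableSet B (Measure.infinitePi fun _ : ι => μ))
    (hB0 : Measure.infinitePi (fun _ : ι => μ) B ≠ 0)
    (hC0 : Measure.infinitePi (fun _ : ι => μ) C ≠ 0) :
    ∃ y ∈ B, ∃ z ∈ C, ∃ F : Finset ι, ∀ i ∉ F, y i = z i := by
  set P := Measure.infinitePi fun _ : ι => μ with hP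
  obtain ⟨B', hB'B, hB', hBe⟩ := hB.exists_measurable_subset_ae_eq
  rw [← measure_congr hBe, ← pos_iff_ne_zero] at hB0
  obtain ⟨K, hKB, hK, hK0⟩ := hB'.exists_lt_isCompact hB0
  set U : Finset ι → Set (ι → X) := fun F => {z | ∃ y ∈ K, ∀ i ∉ F, y i = z i} with hU
  have hUm : ∀ F : Finset ι, MeasurableSet[⨆ i ∈ (F : Set ι)ᶜ,
      MeasurableSpace.comap (fun x : ι → X => x i) inferInstance] (U F) := by
    intro F
    have hr : Continuous ((F : Set ι)ᶜ.domRestrict : (ι → X) → _) :=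
      continuous_pi fun i => continuous_apply _
    have hi := (hK.image hr).isClosed.measurableSet
    have hme : Measurable[⨆ i ∈ (F : Set ι)ᶜ,
        MeasurableSpace.comap (fun x : ι → X => x i) inferInstance]
        ((F : Set ι)ᶜ.domRestrict : (ι → X) → _) := by
      refine @measurable_pi_lambda _ _ _ (_) _ _ fun i => ?_
      refine Measurable.of_comap_le ?_
      exact le_iSup₂_of_le (i : ι) i.2 le_rfl
    convert hme hi using 1
    ext z
    constructor
    · rintro ⟨y, hy, h⟩
      exact ⟨y, hy, funext fun i => h i i.2⟩
    · rintro ⟨y, hy, h⟩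
      exact ⟨y, hy, fun i hi => congrFun h ⟨i, hi⟩⟩
  have hmono : Monotone U := fun F G hFG z ⟨y, hy, h⟩ => ⟨y, hy, fun i hi => h i fun h' => hi (hFG h')⟩
  have htail : MeasurableSet[limsup (fun i => MeasurableSpace.comap (fun x : ι → X => x i)
      inferInstance) cofinite] (⋃ F, U F) := by
    rw [limsup_eq_iInf_iSup]
    simp only [MeasurableSpace.measurableSet_iInf]
    intro s hs
    classical
    set F₀ := (mem_cofinite.1 hs).toFinset with hF₀
    have : ⋃ F, U F = ⋃ F, U (F ∪ F₀) := by
      refine Set.Subset.antisymm (Set.iUnion_mono fun F => hmono Finset.subset_union_left)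
        (Set.iUnion_subset fun F => Set.subset_iUnion U _)
    rw [this]
    refine MeasurableSet.iUnion fun F => ?_
    have hle : (⨆ i ∈ ((F ∪ F₀ : Finset ι) : Set ι)ᶜ,
        MeasurableSpace.comap (fun x : ι → X => x i) inferInstance) ≤
        ⨆ i ∈ s, MeasurableSpace.comap (fun x : ι → X => x i) inferInstance := by
      refine iSup₂_le fun i hi => le_iSup₂_of_le i ?_ le_rfl
      by_contra h
      exact hi (Finset.mem_coe.2 (Finset.mem_union_right _ ((mem_cofinite.1 hs).mem_toFinset.2 h)))
    exact hle _ (hUm (F ∪ F₀))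
  have hind : ProbabilityTheory.iIndep (fun i => MeasurableSpace.comap (fun x : ι → X => x i)
      inferInstance) P :=
    ProbabilityTheory.iIndepFun_infinitePi (P := fun _ : ι => μ) (X := fun _ x => x)
      fun _ => measurable_id
  have h01 := ProbabilityTheory.measure_zero_or_one_of_measurableSet_limsup
    (p := Set.Finite) (ns := fun F : Finset ι => (F : Set ι))
    (fun i => (measurable_pi_apply i).comap_le) hind (fun t ht => by simpa using ht)
    (by classical exact fun F G => ⟨F ∪ G, by simp, by simp⟩) (fun F => F.finite_toSet)
    (fun i => ⟨{i}, by simp⟩) htail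
  have hKU : K ⊆ ⋃ F, U F := fun y hy => Set.mem_iUnion.2 ⟨∅, y, hy, fun _ _ => rfl⟩
  have h1 : P (⋃ F, U F) = 1 := h01.resolve_left (hK0.trans_le (measure_mono hKU)).ne'
  have hUM : MeasurableSet (⋃ F, U F) := MeasurableSet.iUnion fun F => by
    have hle : (⨆ i ∈ (F : Set ι)ᶜ,
        MeasurableSpace.comap (fun x : ι → X => x i) inferInstance) ≤ MeasurableSpace.pi :=
      iSup₂_le fun i _ => (measurable_pi_apply i).comap_le
    exact hle _ (hUm F)
  have h0 : P (⋃ F, U F)ᶜ = 0 := (prob_compl_eq_zero_iff hUM).2 h1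
  obtain ⟨z, hzC, hz⟩ : ∃ z ∈ C, z ∈ ⋃ F, U F := by
    by_contra! h
    exact hC0 (measure_mono_null h h0)
  obtain ⟨F, y, hy, h⟩ := Set.mem_iUnion.1 hz
  exact ⟨y, hB'B (hKB hy), z, hzC, F, h⟩

namespace InfTorus

open Classical in
/-- Gluing the coordinates outside `A` to those in `A` identifies the product of the uniform
measures with the uniform measure. -/
theorem measurePreserving_param (A : Set ℕ) (hA : A.Infinite) :
    MeasurePreserving
      (fun z : (↥Aᶜ → UnitAddCircle) × (A → UnitAddCircle) => ParallelSubtorus.param ⟨A, hA, z.1⟩ z.2)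
      ((Measure.infinitePi fun _ : ↥Aᶜ => (volume : Measure UnitAddCircle)).prod
        (Measure.infinitePi fun _ : A => (volume : Measure UnitAddCircle))) uniform := by
  have hmeas : Measurable (fun z : (↥Aᶜ → UnitAddCircle) × (A → UnitAddCircle) =>
      ParallelSubtorus.param ⟨A, hA, z.1⟩ z.2) := by
    refine measurable_pi_lambda _ fun i => ?_
    by_cases h : i ∈ A
    · simp only [ParallelSubtorus.param, h, dite_true]
      exact (measurable_pi_apply (⟨i, h⟩ : A)).comp measurable_snd
    · simp only [ParallelSubtorus.param, h, dite_false]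
      exact (measurable_pi_apply (⟨i, h⟩ : ↥Aᶜ)).comp measurable_fst
  refine ⟨hmeas, Measure.eq_infinitePi _ fun s t ht => ?_⟩
  rw [Measure.map_apply hmeas (.pi s.countable_toSet fun i _ => ht i)]
  have hpre : (fun z : (↥Aᶜ → UnitAddCircle) × (A → UnitAddCircle) =>
      ParallelSubtorus.param ⟨A, hA, z.1⟩ z.2) ⁻¹' (Set.pi s t) =
      (Set.pi ((s.subtype (· ∈ Aᶜ) : Finset ↥Aᶜ) : Set ↥Aᶜ) fun i => t i) ×ˢ
        (Set.pi ((s.subtype (· ∈ A) : Finset A) : Set A) fun i => t i) := by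
    ext z
    simp only [Set.mem_preimage, Set.mem_pi, Set.mem_prod, Finset.mem_coe, Finset.mem_subtype,
      Subtype.forall]
    constructor
    · exact fun h => ⟨fun i hi his => by
        have hi' : i ∉ A := hi
        simpa [ParallelSubtorus.param, hi'] using h i his,
        fun i hi his => by simpa [ParallelSubtorus.param, hi] using h i his⟩
    · intro h i his
      by_cases hi : i ∈ A
      · simpa [ParallelSubtorus.param, hi] using h.2 i hi his
      · simpa [ParallelSubtorus.param, hi] using h.1 i hi his
  rw [hpre, Measure.prod_prod,
    Measure.infinitePi_pi _ (t := fun i : ↥Aᶜ => t i) fun i _ => ht i,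
    Measure.infinitePi_pi _ (t := fun i : A => t i) fun i _ => ht i,
    Finset.prod_subtype_eq_prod_filter (f := fun i => volume (t i)),
    Finset.prod_subtype_eq_prod_filter (f := fun i => volume (t i)), mul_comm]
  exact Finset.prod_filter_mul_prod_filter_not s (· ∈ A) _

/-- A fibre on which `f` is measurable and a given set of positive measure stays of positive
measure. -/
theorem exists_fibre {A : Set ℕ} (hA : A.Infinite) {f : InfTorus → ℝ}
    (hm : AEMeasurable f uniform) {B : Set InfTorus} (hB : NullMeasurableSet B uniform)
    (hB0 : uniform B ≠ 0) :
    ∃ b : ↥Aᶜ → UnitAddCircle, AEMeasurable f (ParallelSubtorus.uniform ⟨A, hA, b⟩) ∧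
      NullMeasurableSet B (ParallelSubtorus.uniform ⟨A, hA, b⟩) ∧
      ParallelSubtorus.uniform ⟨A, hA, b⟩ B ≠ 0 := by
  have hΦ := measurePreserving_param A hA
  set P₁ := Measure.infinitePi fun _ : ↥Aᶜ => (volume : Measure UnitAddCircle)
  set P₂ := Measure.infinitePi fun _ : A => (volume : Measure UnitAddCircle)
  -- a property valid almost everywhere is valid almost everywhere on almost every fibre
  have hfib : ∀ p : InfTorus → Prop, (∀ᵐ x ∂uniform, p x) →
      ∀ᵐ b ∂P₁, ∀ᵐ x ∂ParallelSubtorus.uniform ⟨A, hA, b⟩, p x := by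
    intro p hp
    obtain ⟨N, hN, hNm, hN0⟩ := exists_measurable_superset_of_null (ae_iff.1 hp)
    have h1 : ∀ᵐ z ∂P₁.prod P₂, ParallelSubtorus.param ⟨A, hA, z.1⟩ z.2 ∉ N :=
      hΦ.quasiMeasurePreserving.ae (compl_mem_ae_iff.2 hN0)
    filter_upwards [Measure.ae_ae_of_ae_prod h1] with b hb
    have h2 : ∀ᵐ x ∂ParallelSubtorus.uniform ⟨A, hA, b⟩, x ∉ N :=
      (ae_map_iff (ParallelSubtorus.measurable_param _).aemeasurable hNm.compl).2 hb
    filter_upwards [h2] with x hx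
    exact not_not.1 fun h => hx (hN h)
  obtain ⟨B', hB'B, hB', hBe⟩ := hB.exists_measurable_subset_ae_eq
  have hpos : ∃ᵐ b ∂P₁, ParallelSubtorus.uniform ⟨A, hA, b⟩ B' ≠ 0 := by
    intro h
    refine hB0 ?_
    rw [← measure_congr hBe, ← hΦ.measure_preimage hB'.nullMeasurableSet,
      Measure.measure_prod_null (hΦ.measurable hB')]
    filter_upwards [h] with b hb
    rw [not_not, ParallelSubtorus.uniform,
      Measure.map_apply (ParallelSubtorus.measurable_param _) hB'] at hb
    exact hb
  obtain ⟨b, hb0, hbf, hbB⟩ :=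
    (hpos.and_eventually ((hfib _ hm.ae_eq_mk).and (hfib _ hBe.mem_iff))).exists
  refine ⟨b, ⟨hm.mk f, hm.measurable_mk, hbf⟩, ?_, fun h => hb0 (measure_mono_null hB'B h)⟩
  exact hB'.nullMeasurableSet.congr (eventuallyEq_set.2 hbB)

end InfTorus

/-! ### The infinite-dimensional spectrum -/

theorem theorem2 (p : ℝ≥0∞) (hp : 1 < p) (f : InfTorus → ℝ)
    (hf : NullMeasurable f InfTorus.uniform) (hL : InfTorus.IsLipschitz p f) :
    ∃ a : ℝ, ∀ ε : ℝ, 0 < ε → ∃ M : ParallelSubtorus,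
      NullMeasurable f M.uniform ∧
        eLpNorm (fun x => f x - a) ∞ M.uniform < ENNReal.ofReal ε := by
  obtain ⟨K, hK, hK0⟩ := hL.exists_isFinLipschitz hp
  have hm : AEMeasurable f InfTorus.uniform := hf.aemeasurable
  have hmap : InfTorus.uniform.map f Set.univ ≠ 0 := by
    have := Measure.isProbabilityMeasure_map hm
    simp
  -- `a` is any point of the support of the law of `f`
  obtain ⟨a, -, ha⟩ := exists_mem_forall_mem_nhdsWithin_pos_measure hmap
  refine ⟨a, fun ε hε => ?_⟩
  set r : ℝ≥0∞ := ENNReal.ofReal (ε / 3) with hr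
  have hr0 : r ≠ 0 := by simpa [hr] using hε
  set J : Set InfTorus := f ⁻¹' Metric.eball a r with hJ
  have hJm : NullMeasurableSet J InfTorus.uniform := hf Metric.isOpen_eball.measurableSet
  have hJ0 : InfTorus.uniform J ≠ 0 := by
    have := ha (Metric.eball a r) (by
      rw [nhdsWithin_univ]; exact Metric.eball_mem_nhds a (pos_iff_ne_zero.2 hr0))
    rw [Measure.map_apply_of_aemeasurable hm Metric.isOpen_eball.measurableSet] at this
    exact this.ne'
  obtain ⟨A, N, hA, hN, hAN⟩ := InfTorus.exists_infinite_finiteChange_le hK hK0 hm hr0 hJ0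
  set G : Set InfTorus := J \ toMeasurable InfTorus.uniform N with hG
  have hGm : NullMeasurableSet G InfTorus.uniform :=
    hJm.diff (measurableSet_toMeasurable _ _).nullMeasurableSet
  have hG0 : InfTorus.uniform G ≠ 0 := by
    intro h
    have := measure_le_inter_add_sdiff InfTorus.uniform J (toMeasurable InfTorus.uniform N)
    rw [h, add_zero] at this
    exact (this.trans (measure_mono Set.inter_subset_right)).not_gt
      ((measure_toMeasurable N).trans_lt hN)
  obtain ⟨b, hbf, hbG, hbG0⟩ := InfTorus.exists_fibre hA hm hGm hG0
  refine ⟨⟨A, hA, b⟩, hbf.nullMeasurable, ?_⟩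
  set M : ParallelSubtorus := ⟨A, hA, b⟩ with hM
  have hMm : AEMeasurable M.param (Measure.infinitePi fun _ : M.A => volume) :=
    M.measurable_param.aemeasurable
  have hae : ∀ᵐ x ∂M.uniform, ‖f x - a‖ₑ ≤ r + r := by
    by_contra hcon
    have hC : NullMeasurableSet {x | ¬ ‖f x - a‖ₑ ≤ r + r} M.uniform :=
      (nullMeasurableSet_le (hbf.sub_const a).enorm aemeasurable_const).compl
    rw [ae_iff, ParallelSubtorus.uniform, Measure.map_apply₀ hMm hC] at hcon
    rw [ParallelSubtorus.uniform, Measure.map_apply₀ hMm hbG] at hbG0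
    obtain ⟨y, hy, z, hz, F, hF⟩ := exists_finite_ne_of_infinitePi_pos volume
      (hbG.preimage ⟨M.measurable_param, Measure.AbsolutelyContinuous.rfl⟩) hbG0 hcon
    refine hz ?_
    have h1 := hAN (M.param y) (fun h => hy.2 (subset_toMeasurable _ _ h)) (M.param z)
      (F.map (Function.Embedding.subtype _))
      (by rw [Finset.coe_map]; rintro _ ⟨i, -, rfl⟩; exact i.2) fun i hi => by
        by_cases h : i ∈ M.A
        · have : (⟨i, h⟩ : M.A) ∉ F := fun hF' => hi (by simpa using ⟨h, hF'⟩)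
          simpa [ParallelSubtorus.param, h] using hF _ this
        · simp [ParallelSubtorus.param, h]
    have h2 : edist (f (M.param y)) a < r := hy.1
    rw [← edist_eq_enorm_sub]
    exact (edist_triangle _ _ _).trans (add_le_add h1 h2.le)
  rw [eLpNorm_exponent_top]
  refine (eLpNormEssSup_le_of_ae_enorm_bound hae).trans_lt ?_
  rw [hr, ← ENNReal.ofReal_add (by positivity) (by positivity)]
  exact (ENNReal.ofReal_lt_ofReal_iff hε).2 (by linarith)
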